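/- A graph $G=(V,E)$ (finite, simple, undirected, with $V\neq\emptyset$) is a \emph{split graph} if $V$ is the disjoint union of a clique and an independent set. A \emph{minimal clique transversal} of $G$ is an inclusion-wise minimal set of vertices that meets every inclusion-wise maximal clique of $G$. The graph $G$ is \emph{clique dually conformal (CDC)} if the hypergraph of its minimal clique transversals is conformal, that is, if every set $S\subseteq V$ such that any two vertices of $S$ lie in a common minimal clique transversal of $G$ is itself contained in a minimal clique transversal of $G$. There exists an algorithm running in time $\mathcal{O}(|V|^8)$ that determines whether a given graph $G=(V,E)$ is a CDC split graph, i.e., both a split graph and CDC. Here running time is measured on the word RAM: there are a single program and constants $c$ and $C$ such that, for every $n\ge 1$, every word length $w\ge c\log_2(n+1)$ and every graph $G$ on $\{0,\dots,n-1\}$, given by its adjacency matrix in memory, the program run on $w$-bit words (with unit cost for each assignment, addition, truncated subtraction, multiplication, memory access and comparison) halts after at most $C n^8$ steps with output $1$ if $G$ is a CDC split graph and output $0$ otherwise. -/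

import Mathlib

/-! ## Hypergraphs: transversals, dual hypergraph, conformality -/

namespace Hypergraph

variable {α : Type*}

/-- A transversal of `H`: a set of vertices that meets every hyperedge. -/
def IsTransversal (H : Hypergraph α) (T : Set α) : Prop :=
  T ⊆ H.vertexSet ∧ ∀ e ∈ H.edgeSet, (T ∩ e).Nonempty

/-- The dual hypergraph of `H`: same vertices, and the hyperedges are the inclusion-wise minimal
transversals of `H`. -/
def transversalDual (H : Hypergraph α) : Hypergraph α where
  vertexSet := H.vertexSet
  edgeSet := {T | Minimal H.IsTransversal T}
  subset_vertexSet_of_mem_edgeSet' := fun _ hT => hT.prop.1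

/-- `H` is conformal: every set of vertices, any two of which belong to a common hyperedge, is
contained in a hyperedge. -/
def IsConformal (H : Hypergraph α) : Prop :=
  ∀ S ⊆ H.vertexSet,
    (∀ u ∈ S, ∀ v ∈ S, u ≠ v → ∃ e ∈ H.edgeSet, u ∈ e ∧ v ∈ e) →
      ∃ e ∈ H.edgeSet, S ⊆ e

/-- `H` is dually conformal: its dual hypergraph is conformal. -/
def IsDuallyConformal (H : Hypergraph α) : Prop :=
  H.transversalDual.IsConformal

end Hypergraph

/-! ## CDC graphs and split graphs -/

namespace SimpleGraph

variable {V : Type*}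

/-- The clique hypergraph of `G`: its hyperedges are the inclusion-wise maximal cliques of `G`. -/
def cliqueHypergraph (G : SimpleGraph V) : Hypergraph V where
  vertexSet := Set.univ
  edgeSet := {C | Maximal (fun S : Set V => G.IsClique S) C}
  subset_vertexSet_of_mem_edgeSet' := fun _ _ => Set.subset_univ _

/-- `G` is clique dually conformal (CDC). -/
def IsCDC (G : SimpleGraph V) : Prop :=
  G.cliqueHypergraph.IsDuallyConformal

/-- `G` is a split graph: the vertex set is the disjoint union of a clique and an
independent set. -/
def IsSplitGraph (G : SimpleGraph V) : Prop :=
  ∃ K I : Set V, G.IsClique K ∧ G.IsIndepSet I ∧ K ∩ I = ∅ ∧ K ∪ I = Set.univ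

end SimpleGraph

/-! ## The machine model: a unit-cost word RAM

A machine has registers `r₀, r₁, …` and a random-access memory, both holding `w`-bit words, that is,
natural numbers below `2 ^ w`. A program mentions finitely many registers, and is a finite text that
depends neither on the input nor on `w`. Memory addresses are words held in registers. -/

namespace WordRAM

/-- The contents of the registers and of the memory. -/
structure State where
  reg : ℕ → ℕ
  mem : ℕ → ℕ

/-- Write `v` into register `x`. -/
def State.setReg (s : State) (x v : ℕ) : State :=
  { s with reg := Function.update s.reg x v }

/-- Write `v` into memory cell `a`. -/
def State.setMem (s : State) (a v : ℕ) : State :=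
  { s with mem := Function.update s.mem a v }

/-- Tests compare two registers. -/
inductive Test where
  | lt (x y : ℕ)
  | eq (x y : ℕ)

/-- The outcome of a test. -/
def Test.Holds : Test → State → Prop
  | .lt x y, s => s.reg x < s.reg y
  | .eq x y, s => s.reg x = s.reg y

/-- Elementary instructions. The arguments `x`, `y`, `z` are names of registers; `k` is a
constant. -/
inductive Instr where
  /-- `r_x := k` -/
  | const (x k : ℕ)
  /-- `r_x := r_y` -/
  | move (x y : ℕ)
  /-- `r_x := r_y + r_z` -/
  | add (x y z : ℕ)
  /-- `r_x := r_y - r_z`, truncated at `0` -/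
  | sub (x y z : ℕ)
  /-- `r_x := r_y * r_z` -/
  | mul (x y z : ℕ)
  /-- `r_x := mem[r_y]` -/
  | load (x y : ℕ)
  /-- `mem[r_x] := r_y` -/
  | store (x y : ℕ)

/-- The effect of an elementary instruction; results are reduced to `w`-bit words. -/
def Instr.apply (w : ℕ) : Instr → State → State
  | .const x k, s => s.setReg x (k % 2 ^ w)
  | .move x y, s => s.setReg x (s.reg y)
  | .add x y z, s => s.setReg x ((s.reg y + s.reg z) % 2 ^ w)
  | .sub x y z, s => s.setReg x (s.reg y - s.reg z)
  | .mul x y z, s => s.setReg x ((s.reg y * s.reg z) % 2 ^ w)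
  | .load x y, s => s.setReg x (s.mem (s.reg y))
  | .store x y, s => s.setMem (s.reg x) (s.reg y)

/-- Programs, built from elementary instructions by sequencing, branching and looping. -/
inductive Program where
  | instr (i : Instr)
  | seq (P Q : Program)
  | ite (b : Test) (P Q : Program)
  | while (b : Test) (P : Program)

/-- `Exec w P s t s'`: on words of `w` bits, the program `P` started in state `s` halts after exactly
`t` steps, in state `s'`. Each elementary instruction takes one step, and so does each evaluation of
a test. -/
inductive Exec (w : ℕ) : Program → State → ℕ → State → Prop where
  | instr (i : Instr) (s : State) : Exec w (.instr i) s 1 (i.apply w s)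
  | seq {P Q : Program} {s s' s'' : State} {t t' : ℕ} :
      Exec w P s t s' → Exec w Q s' t' s'' → Exec w (.seq P Q) s (t + t') s''
  | ite_true {b : Test} {P Q : Program} {s s' : State} {t : ℕ} :
      b.Holds s → Exec w P s t s' → Exec w (.ite b P Q) s (t + 1) s'
  | ite_false {b : Test} {P Q : Program} {s s' : State} {t : ℕ} :
      ¬ b.Holds s → Exec w Q s t s' → Exec w (.ite b P Q) s (t + 1) s'
  | while_true {b : Test} {P : Program} {s s' s'' : State} {t t' : ℕ} :
      b.Holds s → Exec w P s t s' → Exec w (.while b P) s' t' s'' →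
        Exec w (.while b P) s (t + t' + 1) s''
  | while_false {b : Test} {P : Program} {s : State} :
      ¬ b.Holds s → Exec w (.while b P) s 1 s

open Classical in
/-- The initial state on the graph `G` with vertices `0, …, n - 1`: register `r₀` holds `n`, memory
cell `i * n + j` holds the entry `(i, j)` of the adjacency matrix of `G`, and everything else
is `0`. -/
noncomputable def graphInput {n : ℕ} (G : SimpleGraph (Fin n)) : State where
  reg := fun x => if x = 0 then n else 0
  mem := fun a => if ∃ i j : Fin n, a = i.val * n + j.val ∧ G.Adj i j then 1 else 0

/-- The program `P`, on words of `w` bits and on the graph `G` as input, answers whether `G` has the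
property `A`, after at most `T` steps: it halts with `1` in register `r₀` if `A` is true, and with
`0` in `r₀` otherwise. -/
def Answers (P : Program) (w : ℕ) {n : ℕ} (G : SimpleGraph (Fin n)) (A : Prop) (T : ℕ) : Prop :=
  ∃ (t : ℕ) (s : State), Exec w P (graphInput G) t s ∧ t ≤ T ∧
    (A → s.reg 0 = 1) ∧ (¬ A → s.reg 0 = 0)

end WordRAM

/-! ## Split partitions and their minimal clique transversals -/

namespace SimpleGraph

variable {V : Type*} {G : SimpleGraph V} {K : Set V}

/-! Let K be a maximal clique with independent complement. The maximal cliques are then K and the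
closed neighbourhoods of the vertices outside K. Hence a minimal transversal is determined by its
trace X on K: it is `completion K X`, where X is nonempty and, unless X is a singleton, each of its
members has a neighbour outside K that no other member sees. Two vertices of K share a minimal
transversal exactly when they are incomparable.

Conformality therefore splits into `PrivateCondition`, for the sets that meet K, and
`HellyCondition`, for those that avoid K (`privateCondition_of_isCDC`, `hellyCondition_of_isCDC`,
`isCDC_of_conditions`). Moreover K is `splitKernel x` for a suitable vertex x
(`exists_eq_splitKernel`), so being a CDC split graph is a first-order sentence about adjacency.
Nested loops evaluate such a sentence, each quantifier costing a factor n (`Decides.all`,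
`Decides.ex`). The nesting depth is 7, within the exponent 8. -/

/-- `K` is a maximal clique whose complement is independent. -/
structure IsSplitPartition (G : SimpleGraph V) (K : Set V) : Prop where
  clique : ∀ a b, a ∈ K → b ∈ K → a ≠ b → G.Adj a b
  indep : ∀ a b, a ∉ K → b ∉ K → ¬ G.Adj a b
  maximal : ∀ a, a ∉ K → ∃ b, b ∈ K ∧ ¬ G.Adj a b

/-- `x` has a neighbour outside `K` that is not a neighbour of `y`. -/
def HasExtraNeighbor (G : SimpleGraph V) (K : Set V) (x y : V) : Prop :=
  ∃ u, u ∉ K ∧ G.Adj x u ∧ ¬ G.Adj y u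

/-- `x` and `y` have incomparable neighbourhoods outside `K`. -/
def Incomparable (G : SimpleGraph V) (K : Set V) (x y : V) : Prop :=
  G.HasExtraNeighbor K x y ∧ G.HasExtraNeighbor K y x

/-- Each vertex of `K` has, outside `K`, a neighbour adjacent to no incomparable vertex of `K`,
provided that there are incomparable vertices. -/
def PrivateCondition (G : SimpleGraph V) (K : Set V) : Prop :=
  ∀ x y₀, x ∈ K → y₀ ∈ K → G.Incomparable K x y₀ →
    ∃ v, v ∉ K ∧ G.Adj x v ∧ ∀ y, y ∈ K → G.Incomparable K x y → ¬ G.Adj y v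

/-- `v` is nonadjacent to at least two of `x`, `y`, `z`. -/
def MissesTwo (G : SimpleGraph V) (x y z v : V) : Prop :=
  (¬ G.Adj x v ∧ ¬ G.Adj y v) ∨ (¬ G.Adj x v ∧ ¬ G.Adj z v) ∨ (¬ G.Adj y v ∧ ¬ G.Adj z v)

/-- The Berge–Gilmore criterion for the Helly property of the sets of nonneighbours in `K` of the
vertices outside `K`. -/
def HellyCondition (G : SimpleGraph V) (K : Set V) : Prop :=
  ∀ x y z, x ∈ K → y ∈ K → z ∈ K →
    ∃ w, w ∈ K ∧ ∀ v, v ∉ K → G.MissesTwo x y z v → ¬ G.Adj w v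

/-- The extension of `X ⊆ K` by the vertices outside `K` without neighbours in `X`. -/
def completion (G : SimpleGraph V) (K X : Set V) : Set V :=
  X ∪ {v | v ∉ K ∧ ∀ x ∈ X, ¬ G.Adj x v}

namespace IsSplitPartition

/-! ### Maximal cliques and transversals of a split graph -/

lemma mem_of_adj (h : G.IsSplitPartition K) {u v : V} (hv : v ∉ K) (huv : G.Adj u v) : u ∈ K := by
  by_contra hu
  exact h.indep _ _ hu hv huv

lemma isClique (h : G.IsSplitPartition K) : G.IsClique K :=
  fun a ha b hb hab => h.clique a b ha hb hab

lemma mem_edgeSet_self (h : G.IsSplitPartition K) : K ∈ G.cliqueHypergraph.edgeSet := by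
  refine ⟨h.isClique, fun C hC hKC v hv => ?_⟩
  by_contra hvK
  obtain ⟨b, hb, hvb⟩ := h.maximal v hvK
  exact hvb (hC hv (hKC hb) (fun e => hvK (e ▸ hb)))

lemma mem_edgeSet_neighbors (h : G.IsSplitPartition K) {v : V} (hv : v ∉ K) :
    {u | u = v ∨ G.Adj u v} ∈ G.cliqueHypergraph.edgeSet := by
  refine ⟨?_, fun C hC hsub u hu => ?_⟩
  · rintro a (rfl | ha) b (rfl | hb) hab
    · exact absurd rfl hab
    · exact hb.symm
    · exact ha
    · exact h.clique a b (h.mem_of_adj hv ha) (h.mem_of_adj hv hb) hab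
  · by_cases huv : u = v
    · exact Or.inl huv
    · exact Or.inr (hC hu (hsub (Or.inl rfl)) huv)

lemma eq_or_of_mem_edgeSet (h : G.IsSplitPartition K) {C : Set V}
    (hC : C ∈ G.cliqueHypergraph.edgeSet) :
    C = K ∨ ∃ v, v ∉ K ∧ C = {u | u = v ∨ G.Adj u v} := by
  by_cases hCK : C ⊆ K
  · exact Or.inl (hCK.antisymm (hC.2 h.isClique hCK))
  · obtain ⟨v, hvC, hvK⟩ := Set.not_subset.1 hCK
    have hsub : C ⊆ {u | u = v ∨ G.Adj u v} := by
      intro u hu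
      by_cases huv : u = v
      · exact Or.inl huv
      · exact Or.inr (hC.1 hu hvC huv)
    exact Or.inr ⟨v, hvK, hsub.antisymm (hC.2 (h.mem_edgeSet_neighbors hvK).1 hsub)⟩

lemma isTransversal_iff (h : G.IsSplitPartition K) {T : Set V} :
    G.cliqueHypergraph.IsTransversal T ↔
      (∃ x ∈ T, x ∈ K) ∧ ∀ v, v ∉ K → v ∈ T ∨ ∃ x ∈ T, G.Adj x v := by
  constructor
  · rintro ⟨-, hT⟩
    refine ⟨hT K h.mem_edgeSet_self, fun v hv => ?_⟩
    obtain ⟨x, hxT, rfl | hx⟩ := hT _ (h.mem_edgeSet_neighbors hv)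
    · exact Or.inl hxT
    · exact Or.inr ⟨x, hxT, hx⟩
  · rintro ⟨hK, hI⟩
    refine ⟨Set.subset_univ _, fun C hC => ?_⟩
    obtain rfl | ⟨v, hv, rfl⟩ := h.eq_or_of_mem_edgeSet hC
    · exact hK
    · obtain hvT | ⟨x, hxT, hx⟩ := hI v hv
      · exact ⟨v, hvT, Or.inl rfl⟩
      · exact ⟨x, hxT, Or.inr hx⟩

lemma exists_mem_of_minimal (h : G.IsSplitPartition K) {T : Set V}
    (hT : Minimal G.cliqueHypergraph.IsTransversal T) : ∃ x ∈ T, x ∈ K :=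
  (h.isTransversal_iff.1 hT.1).1

/-- The only maximal clique through v is its closed neighbourhood, so v is redundant once a
neighbour of v is in T. -/
lemma not_adj_of_minimal (h : G.IsSplitPartition K) {T : Set V}
    (hT : Minimal G.cliqueHypergraph.IsTransversal T) {x v : V} (hv : v ∉ K) (hvT : v ∈ T)
    (hxT : x ∈ T) : ¬ G.Adj x v := by
  intro hxv
  have hxK := h.mem_of_adj hv hxv
  have hne : x ≠ v := fun e => hv (e ▸ hxK)
  obtain ⟨-, hI⟩ := h.isTransversal_iff.1 hT.1
  have hS : G.cliqueHypergraph.IsTransversal (T \ {v}) := by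
    refine h.isTransversal_iff.2 ⟨⟨x, ⟨hxT, hne⟩, hxK⟩, fun u hu => ?_⟩
    by_cases huv : u = v
    · exact Or.inr ⟨x, ⟨hxT, hne⟩, huv ▸ hxv⟩
    · obtain huT | ⟨y, hyT, hy⟩ := hI u hu
      · exact Or.inl ⟨huT, huv⟩
      · exact Or.inr ⟨y, ⟨hyT, fun e => hv (e ▸ h.mem_of_adj hu hy)⟩, hy⟩
  exact (hT.2 hS Set.sdiff_subset hvT).2 rfl

/-- Removing x must leave some maximal clique unmet. It is not K, which y still meets, so it is the
closed neighbourhood of some v. -/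
lemma exists_private_of_minimal (h : G.IsSplitPartition K) {T : Set V}
    (hT : Minimal G.cliqueHypergraph.IsTransversal T) {x y : V} (hxT : x ∈ T) (hxK : x ∈ K)
    (hyT : y ∈ T) (hyK : y ∈ K) (hxy : y ≠ x) :
    ∃ v, v ∉ K ∧ G.Adj x v ∧ ∀ z ∈ T, z ≠ x → ¬ G.Adj z v := by
  by_contra! hcon
  obtain ⟨-, hI⟩ := h.isTransversal_iff.1 hT.1
  have hS : G.cliqueHypergraph.IsTransversal (T \ {x}) := by
    refine h.isTransversal_iff.2 ⟨⟨y, ⟨hyT, hxy⟩, hyK⟩, fun u hu => ?_⟩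
    obtain huT | ⟨z, hzT, hz⟩ := hI u hu
    · exact Or.inl ⟨huT, fun e => hu (e ▸ hxK)⟩
    · by_cases hzx : z = x
      · obtain ⟨z', hz'T, hz'x, hz'⟩ := hcon u hu (hzx ▸ hz)
        exact Or.inr ⟨z', ⟨hz'T, hz'x⟩, hz'⟩
      · exact Or.inr ⟨z, ⟨hzT, hzx⟩, hz⟩
  exact (hT.2 hS Set.sdiff_subset hxT).2 rfl

/-- Every vertex is critical: a lone vertex of X for K, another vertex of X for the closed
neighbourhood of its private neighbour, an added vertex for its own closed neighbourhood. -/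
lemma minimal_completion (h : G.IsSplitPartition K) {X : Set V} (hXK : X ⊆ K) (hne : X.Nonempty)
    (hX : ∀ x ∈ X, (∀ y ∈ X, y = x) ∨
      ∃ v, v ∉ K ∧ G.Adj x v ∧ ∀ y ∈ X, y ≠ x → ¬ G.Adj y v) :
    Minimal G.cliqueHypergraph.IsTransversal (G.completion K X) := by
  have hmem : ∀ y ∈ G.completion K X, y ∈ K → y ∈ X := by
    rintro y (hy | hy) hyK
    · exact hy
    · exact absurd hyK hy.1
  refine ⟨h.isTransversal_iff.2 ⟨?_, fun v hv => ?_⟩, fun S hS hST t ht => ?_⟩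
  · obtain ⟨x, hx⟩ := hne
    exact ⟨x, Or.inl hx, hXK hx⟩
  · by_cases hvX : ∀ x ∈ X, ¬ G.Adj x v
    · exact Or.inl (Or.inr ⟨hv, hvX⟩)
    · push Not at hvX
      obtain ⟨x, hx, hxv⟩ := hvX
      exact Or.inr ⟨x, Or.inl hx, hxv⟩
  · obtain ⟨⟨s, hsS, hsK⟩, hI⟩ := h.isTransversal_iff.1 hS
    rcases ht with ht | ht
    · obtain hsing | ⟨v, hv, htv, hpriv⟩ := hX t ht
      · exact hsing s (hmem s (hST hsS) hsK) ▸ hsS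
      · obtain hvS | ⟨y, hyS, hyv⟩ := hI v hv
        · rcases hST hvS with hvX | hvX
          · exact absurd (hXK hvX) hv
          · exact absurd htv (hvX.2 t ht)
        · by_cases hyt : y = t
          · exact hyt ▸ hyS
          · exact absurd hyv (hpriv y (hmem y (hST hyS) (h.mem_of_adj hv hyv)) hyt)
    · obtain htS | ⟨y, hyS, hyt⟩ := hI t ht.1
      · exact htS
      · exact absurd hyt (ht.2 y (hmem y (hST hyS) (h.mem_of_adj ht.1 hyt)))

lemma minimal_completion_singleton (h : G.IsSplitPartition K) {x : V} (hx : x ∈ K) :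
    Minimal G.cliqueHypergraph.IsTransversal (G.completion K {x}) :=
  h.minimal_completion (Set.singleton_subset_iff.2 hx) (Set.singleton_nonempty x)
    (fun y hy => Or.inl fun z hz => by
      rw [Set.mem_singleton_iff] at hy hz
      rw [hy, hz])

lemma minimal_completion_pair (h : G.IsSplitPartition K) {x y : V} (hx : x ∈ K) (hy : y ∈ K)
    (hxy : G.Incomparable K x y) :
    Minimal G.cliqueHypergraph.IsTransversal (G.completion K {x, y}) := by
  refine h.minimal_completion (Set.insert_subset hx (Set.singleton_subset_iff.2 hy))
    (Set.insert_nonempty x _) ?_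
  obtain ⟨⟨u, hu, hxu, hyu⟩, ⟨v, hv, hyv, hxv⟩⟩ := hxy
  rintro z (rfl | rfl)
  · refine Or.inr ⟨u, hu, hxu, ?_⟩
    rintro _ (rfl | rfl) hne
    · exact absurd rfl hne
    · exact hyu
  · refine Or.inr ⟨v, hv, hyv, ?_⟩
    rintro _ (rfl | rfl) hne
    · exact hxv
    · exact absurd rfl hne

lemma incomparable_of_minimal (h : G.IsSplitPartition K) {T : Set V}
    (hT : Minimal G.cliqueHypergraph.IsTransversal T) {x y : V} (hxT : x ∈ T) (hxK : x ∈ K)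
    (hyT : y ∈ T) (hyK : y ∈ K) (hxy : x ≠ y) : G.Incomparable K x y := by
  obtain ⟨u, hu, hxu, hu'⟩ := h.exists_private_of_minimal hT hxT hxK hyT hyK hxy.symm
  obtain ⟨v, hv, hyv, hv'⟩ := h.exists_private_of_minimal hT hyT hyK hxT hxK hxy
  exact ⟨⟨u, hu, hxu, hu' y hyT hxy.symm⟩, ⟨v, hv, hyv, hv' x hxT hxy⟩⟩

/-! ### Necessity of the two conditions -/

/-- Among the vertices incomparable to x, pick one per inclusion-maximal outer neighbourhood. With x
they are pairwise incomparable, so conformality puts them all in one T. The private neighbour of x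
in T avoids the maximal neighbourhoods, hence all of them. -/
lemma privateCondition_of_isCDC [Finite V] (h : G.IsSplitPartition K) (hG : G.IsCDC) :
    G.PrivateCondition K := by
  classical
  intro x y₀ hx hy₀ hxy₀
  let N : V → Set V := fun y => {u | u ∉ K ∧ G.Adj y u}
  let Y : Set V := {y | y ∈ K ∧ G.Incomparable K x y}
  let M : Set (Set V) := {m | Maximal (· ∈ N '' Y) m}
  have hf : ∀ m : Set V, ∃ y, m ∈ M → y ∈ Y ∧ N y = m := by
    intro m
    by_cases hm : m ∈ M
    · obtain ⟨y, hy, hym⟩ := hm.1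
      exact ⟨y, fun _ => ⟨hy, hym⟩⟩
    -- The value x is a dummy: f matters only on M.
    · exact ⟨x, fun h => absurd h hm⟩
  choose f hf using hf
  have hcover : ∀ y ∈ Y, ∃ m ∈ M, N y ⊆ m := by
    intro y hy
    obtain ⟨m, hym, hm⟩ := (Set.toFinite (N '' Y)).exists_le_maximal (Set.mem_image_of_mem N hy)
    exact ⟨m, hm, hym⟩
  have hextra : ∀ m ∈ M, ∀ m' ∈ M, m ≠ m' → G.HasExtraNeighbor K (f m) (f m') := by
    intro m hm m' hm' hne
    have hsub : ¬ N (f m) ⊆ N (f m') := by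
      rw [(hf m hm).2, (hf m' hm').2]
      exact fun hle => hne (hle.antisymm (hm.2 hm'.1 hle))
    obtain ⟨u, hu, hu'⟩ := Set.not_subset.1 hsub
    exact ⟨u, hu.1, hu.2, fun hadj => hu' ⟨hu.1, hadj⟩⟩
  have hinc : ∀ u ∈ insert x (f '' M), ∀ v ∈ insert x (f '' M), u ≠ v →
      G.Incomparable K u v := by
    rintro u (rfl | ⟨m, hm, rfl⟩) v (rfl | ⟨m', hm', rfl⟩) huv
    · exact absurd rfl huv
    · exact (hf m' hm').1.2
    · exact (hf m hm).1.2.symm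
    · have hne : m ≠ m' := fun e => huv (e ▸ rfl)
      exact ⟨hextra m hm m' hm' hne, hextra m' hm' m hm hne.symm⟩
  have hAK : ∀ u ∈ insert x (f '' M), u ∈ K := by
    rintro u (rfl | ⟨m, hm, rfl⟩)
    · exact hx
    · exact (hf m hm).1.1
  obtain ⟨T, hT, hAT⟩ := hG (insert x (f '' M)) (Set.subset_univ _) fun u hu v hv huv =>
    ⟨_, h.minimal_completion_pair (hAK u hu) (hAK v hv) (hinc u hu v hv huv),
      Or.inl (Set.mem_insert u _), Or.inl (Set.mem_insert_of_mem u rfl)⟩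
  have hne : ∀ m ∈ M, f m ≠ x := by
    intro m hm e
    obtain ⟨⟨u, -, hu, hu'⟩, -⟩ := (hf m hm).1.2
    exact hu' (e ▸ hu)
  have hfT : ∀ m ∈ M, f m ∈ T := fun m hm =>
    hAT (Set.mem_insert_of_mem x (Set.mem_image_of_mem f hm))
  obtain ⟨m₀, hm₀, -⟩ := hcover y₀ ⟨hy₀, hxy₀⟩
  -- The vertex y₀ serves only to make M nonempty, so that T has a second vertex in K.
  obtain ⟨v, hv, hxv, hpriv⟩ := h.exists_private_of_minimal hT (hAT (Set.mem_insert x _)) hx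
    (hfT m₀ hm₀) (hf m₀ hm₀).1.1 (hne m₀ hm₀)
  refine ⟨v, hv, hxv, fun y hy hxy hyv => ?_⟩
  obtain ⟨m, hm, hsub⟩ := hcover y ⟨hy, hxy⟩
  have hvm : v ∈ N (f m) := by
    rw [(hf m hm).2]
    exact hsub ⟨hv, hyv⟩
  exact hpriv (f m) (hfT m hm) (hne m hm) hvm.2

/-- Apply conformality to the set of outer vertices missing two of x, y, z. By pigeonhole any two of
them miss a common p among the three, so `completion K {p}` contains both. -/
lemma hellyCondition_of_isCDC (h : G.IsSplitPartition K) (hG : G.IsCDC) :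
    G.HellyCondition K := by
  intro x y z hx hy hz
  obtain ⟨T, hT, hBT⟩ := hG {v | v ∉ K ∧ G.MissesTwo x y z v} (Set.subset_univ _) (by
    rintro u ⟨hu, hu'⟩ v ⟨hv, hv'⟩ -
    have hp : ∃ p ∈ K, ¬ G.Adj p u ∧ ¬ G.Adj p v := by
      unfold MissesTwo at hu' hv'
      by_cases hxuv : ¬ G.Adj x u ∧ ¬ G.Adj x v
      · exact ⟨x, hx, hxuv⟩
      by_cases hyuv : ¬ G.Adj y u ∧ ¬ G.Adj y v
      · exact ⟨y, hy, hyuv⟩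
      · exact ⟨z, hz, by tauto⟩
    obtain ⟨p, hp, hpu, hpv⟩ := hp
    refine ⟨_, h.minimal_completion_singleton hp, Or.inr ⟨hu, ?_⟩, Or.inr ⟨hv, ?_⟩⟩
    · rintro _ rfl
      exact hpu
    · rintro _ rfl
      exact hpv)
  obtain ⟨w, hwT, hwK⟩ := h.exists_mem_of_minimal hT
  exact ⟨w, hwK, fun v hv hv' => h.not_adj_of_minimal hT hv (hBT ⟨hv, hv'⟩) hwT⟩

/-! ### Sufficiency of the two conditions -/

/-- The Helly property for the sets of nonneighbours. -/
lemma exists_common_nonneighbor (hne : K.Nonempty) (hH : G.HellyCondition K) (B : Finset V)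
    (hB : ∀ v ∈ B, v ∉ K) (hpair : ∀ u ∈ B, ∀ v ∈ B, ∃ w ∈ K, ¬ G.Adj w u ∧ ¬ G.Adj w v) :
    ∃ w ∈ K, ∀ v ∈ B, ¬ G.Adj w v := by
  classical
  induction B using Finset.strongInduction with
  | H B ih =>
    -- Deleting a, b or c from B gives, by induction, witnesses x, y, z. Each v in B differs from
    -- two of a, b, c, hence misses two of x, y, z.
    by_cases hcard : 2 < B.card
    · obtain ⟨a, ha, b, hb, c, hc, hab, hac, hbc⟩ := Finset.two_lt_card.1 hcard
      have herase : ∀ p ∈ B, ∃ w ∈ K, ∀ v ∈ B, v ≠ p → ¬ G.Adj w v := by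
        intro p hp
        obtain ⟨w, hw, hwv⟩ := ih (B.erase p) (Finset.erase_ssubset hp)
          (fun v hv => hB v (Finset.mem_of_mem_erase hv))
          (fun u hu v hv => hpair u (Finset.mem_of_mem_erase hu) v (Finset.mem_of_mem_erase hv))
        exact ⟨w, hw, fun v hv hvp => hwv v (Finset.mem_erase.2 ⟨hvp, hv⟩)⟩
      obtain ⟨x, hx, hx'⟩ := herase a ha
      obtain ⟨y, hy, hy'⟩ := herase b hb
      obtain ⟨z, hz, hz'⟩ := herase c hc
      obtain ⟨w, hw, hw'⟩ := hH x y z hx hy hz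
      refine ⟨w, hw, fun v hv => hw' v (hB v hv) ?_⟩
      by_cases hva : v = a
      · exact Or.inr (Or.inr ⟨hy' v hv (hva ▸ hab), hz' v hv (hva ▸ hac)⟩)
      by_cases hvb : v = b
      · exact Or.inr (Or.inl ⟨hx' v hv hva, hz' v hv (hvb ▸ hbc)⟩)
      · exact Or.inl ⟨hx' v hv hva, hy' v hv hvb⟩
    · rcases B.eq_empty_or_nonempty with rfl | ⟨u, hu⟩
      · obtain ⟨w, hw⟩ := hne
        exact ⟨w, hw, by simp⟩
      by_cases hu' : ∀ v ∈ B, v = u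
      · obtain ⟨w, hw, hwu, -⟩ := hpair u hu u hu
        exact ⟨w, hw, fun v hv => hu' v hv ▸ hwu⟩
      · push Not at hu'
        obtain ⟨v, hv, hvu⟩ := hu'
        obtain ⟨w, hw, hwu, hwv⟩ := hpair u hu v hv
        refine ⟨w, hw, fun b hb hwb => hcard (Finset.two_lt_card.2
          ⟨u, hu, v, hv, b, hb, hvu.symm, ?_, ?_⟩)⟩
        · rintro rfl
          exact hwu hwb
        · rintro rfl
          exact hwv hwb

/-- If S meets K, the completion of S ∩ K is minimal by `PrivateCondition` and contains S. Otherwise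
the Helly property yields a common nonneighbour w in K, and the completion of {w} contains S. -/
lemma isCDC_of_conditions [Finite V] (h : G.IsSplitPartition K) (hne : K.Nonempty)
    (hP : G.PrivateCondition K) (hH : G.HellyCondition K) : G.IsCDC := by
  intro S _ hS
  have hcommon : ∀ u ∈ S, ∀ v ∈ S, u ≠ v →
      ∃ T, Minimal G.cliqueHypergraph.IsTransversal T ∧ u ∈ T ∧ v ∈ T := hS
  by_cases hSK : (S ∩ K).Nonempty
  · have hinc : ∀ x ∈ S ∩ K, ∀ y ∈ S ∩ K, x ≠ y → G.Incomparable K x y := by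
      rintro x ⟨hxS, hxK⟩ y ⟨hyS, hyK⟩ hxy
      obtain ⟨T, hT, hxT, hyT⟩ := hcommon x hxS y hyS hxy
      exact h.incomparable_of_minimal hT hxT hxK hyT hyK hxy
    refine ⟨G.completion K (S ∩ K), h.minimal_completion Set.inter_subset_right hSK ?_, ?_⟩
    · intro x hx
      by_cases hx' : ∀ y ∈ S ∩ K, y = x
      · exact Or.inl hx'
      · push Not at hx'
        obtain ⟨y₀, hy₀, hy₀x⟩ := hx'
        obtain ⟨v, hv, hxv, hpriv⟩ := hP x y₀ hx.2 hy₀.2 (hinc x hx y₀ hy₀ hy₀x.symm)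
        exact Or.inr ⟨v, hv, hxv, fun y hy hyx => hpriv y hy.2 (hinc x hx y hy hyx.symm)⟩
    · intro v hv
      by_cases hvK : v ∈ K
      · exact Or.inl ⟨hv, hvK⟩
      · refine Or.inr ⟨hvK, fun x hx => ?_⟩
        obtain ⟨T, hT, hxT, hvT⟩ := hcommon x hx.1 v hv (fun e => hvK (e ▸ hx.2))
        exact h.not_adj_of_minimal hT hvK hvT hxT
  · have hSK' : ∀ v ∈ S, v ∉ K := fun v hv hvK => hSK ⟨v, hv, hvK⟩
    obtain ⟨w, hw, hwS⟩ := exists_common_nonneighbor hne hH (Set.toFinite S).toFinset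
      (fun v hv => hSK' v ((Set.toFinite S).mem_toFinset.1 hv)) (by
        intro u hu v hv
        rw [Set.Finite.mem_toFinset] at hu hv
        by_cases huv : u = v
        · obtain ⟨w, hw, hwu⟩ := h.maximal u (hSK' u hu)
          have hwu' : ¬ G.Adj w u := fun e => hwu e.symm
          exact ⟨w, hw, hwu', huv ▸ hwu'⟩
        · obtain ⟨T, hT, huT, hvT⟩ := hcommon u hu v hv huv
          obtain ⟨w, hwT, hwK⟩ := h.exists_mem_of_minimal hT
          exact ⟨w, hwK, h.not_adj_of_minimal hT (hSK' u hu) huT hwT,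
            h.not_adj_of_minimal hT (hSK' v hv) hvT hwT⟩)
    refine ⟨_, h.minimal_completion_singleton hw, fun v hv => Or.inr ⟨hSK' v hv, ?_⟩⟩
    rintro _ rfl
    exact hwS v ((Set.toFinite S).mem_toFinset.2 hv)

end IsSplitPartition

/-! ## A first-order description of split partitions -/

/-- The twins of `x` and the neighbours of nonneighbours of `x`. -/
def splitKernel (G : SimpleGraph V) (x : V) : Set V :=
  {y | (∀ z, (z = x ∨ G.Adj z x) ↔ (z = y ∨ G.Adj z y)) ∨
    ∃ u, ¬ u = x ∧ ¬ G.Adj u x ∧ G.Adj u y}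

lemma mem_splitKernel_self (G : SimpleGraph V) (x : V) : x ∈ G.splitKernel x :=
  Or.inl fun _ => Iff.rfl

lemma IsSplitPartition.isSplitGraph (h : G.IsSplitPartition K) : G.IsSplitGraph :=
  ⟨K, Kᶜ, h.isClique, fun a ha b hb _ => h.indep a b ha hb, Set.inter_compl_self K,
    Set.union_compl_self K⟩

/-- If some v outside K is adjacent to all of K, adding this one vertex is enough: no remaining
outer vertex is adjacent to v. -/
lemma IsSplitGraph.exists_isSplitPartition (hG : G.IsSplitGraph) :
    ∃ K, G.IsSplitPartition K := by
  obtain ⟨K, I, hK, hI, -, hKI⟩ := hG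
  have hI' : ∀ a, a ∉ K → a ∈ I := fun a ha =>
    (show a ∈ K ∪ I from hKI ▸ Set.mem_univ a).resolve_left ha
  have hindep : ∀ a b, a ∉ K → b ∉ K → ¬ G.Adj a b := fun a b ha hb hab =>
    hI (hI' a ha) (hI' b hb) hab.ne hab
  by_cases hmax : ∀ a, a ∉ K → ∃ b, b ∈ K ∧ ¬ G.Adj a b
  · exact ⟨K, fun a b ha hb hab => hK ha hb hab, hindep, hmax⟩
  · push Not at hmax
    obtain ⟨v, hv, hvK⟩ := hmax
    refine ⟨insert v K, ?_, ?_, ?_⟩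
    · rintro a b (rfl | ha) (rfl | hb) hab
      · exact absurd rfl hab
      · exact hvK b hb
      · exact (hvK a ha).symm
      · exact hK ha hb hab
    · exact fun a b ha hb => hindep a b (fun h => ha (Or.inr h)) (fun h => hb (Or.inr h))
    · exact fun a ha => ⟨v, Or.inl rfl, hindep a v (fun h => ha (Or.inr h)) hv⟩

/-- Take x in K with inclusion-minimal outer neighbourhood. A vertex y of K either has an outer
neighbour that x lacks or, by minimality, is a twin of x. Conversely, nonneighbours of x are outside
K, so their neighbours are in K, and an outer twin of x would see all of K. -/
lemma IsSplitPartition.exists_eq_splitKernel [Finite V] [Nonempty V] (h : G.IsSplitPartition K) :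
    ∃ x, G.splitKernel x = K := by
  have hne : K.Nonempty := by
    by_contra hK
    rw [Set.not_nonempty_iff_eq_empty] at hK
    obtain ⟨b, hb, -⟩ := h.maximal (Classical.arbitrary V) (hK ▸ Set.notMem_empty _)
    exact Set.notMem_empty b (hK ▸ hb)
  obtain ⟨x, hx, hmin⟩ := (Set.toFinite K).exists_minimalFor
    (fun y => {u | u ∉ K ∧ G.Adj y u}) K hne
  refine ⟨x, Set.ext fun y => ⟨?_, fun hy => ?_⟩⟩
  · rintro (htwin | ⟨u, hux, hux', huy⟩)
    · by_contra hy
      obtain ⟨b, hb, hyb⟩ := h.maximal y hy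
      have hbx : b = x ∨ G.Adj b x := by
        by_cases hbx : b = x
        · exact Or.inl hbx
        · exact Or.inr (h.clique b x hb hx hbx)
      obtain rfl | hby := (htwin b).1 hbx
      · exact hy hb
      · exact hyb hby.symm
    · have hu : u ∉ K := fun hu => hux' (h.clique u x hu hx hux)
      exact h.mem_of_adj hu huy.symm
  · by_cases hex : ∃ u, u ∉ K ∧ G.Adj u y ∧ ¬ G.Adj u x
    · obtain ⟨u, hu, huy, hux⟩ := hex
      exact Or.inr ⟨u, fun e => hu (e ▸ hx), hux, huy⟩
    · push Not at hex
      have hle := hmin hy (fun u hu => ⟨hu.1, (hex u hu.1 hu.2.symm).symm⟩)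
      refine Or.inl fun z => ?_
      by_cases hz : z ∈ K
      · have hadj : ∀ p ∈ K, z = p ∨ G.Adj z p := fun p hp =>
          (em (z = p)).imp_right (h.clique z p hz hp)
        exact iff_of_true (hadj x hx) (hadj y hy)
      · have hzx : z ≠ x := fun e => hz (e ▸ hx)
        have hzy : z ≠ y := fun e => hz (e ▸ hy)
        simp only [hzx, hzy, false_or]
        exact ⟨fun hadj => (hle ⟨hz, hadj.symm⟩).2.symm, hex z hz⟩

/-- The first-order criterion evaluated by the program. -/
def SplitCDCCriterion (G : SimpleGraph V) (K : Set V) : Prop :=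
  ((∀ a b, a ∈ K → b ∈ K → ¬ a = b → G.Adj a b) ∧
    (∀ a b, a ∉ K → b ∉ K → ¬ G.Adj a b) ∧ ∀ a, a ∉ K → ∃ b, b ∈ K ∧ ¬ G.Adj a b) ∧
  G.PrivateCondition K ∧ G.HellyCondition K

lemma isSplitGraph_and_isCDC_iff [Finite V] [Nonempty V] :
    G.IsSplitGraph ∧ G.IsCDC ↔ ∃ x, G.SplitCDCCriterion (G.splitKernel x) := by
  constructor
  · rintro ⟨hsplit, hG⟩
    obtain ⟨K, hK⟩ := hsplit.exists_isSplitPartition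
    obtain ⟨x, rfl⟩ := hK.exists_eq_splitKernel
    exact ⟨x, ⟨hK.clique, hK.indep, hK.maximal⟩, hK.privateCondition_of_isCDC hG,
      hK.hellyCondition_of_isCDC hG⟩
  · rintro ⟨x, ⟨h₁, h₂, h₃⟩, hP, hH⟩
    have hK : G.IsSplitPartition (G.splitKernel x) := ⟨h₁, h₂, h₃⟩
    exact ⟨hK.isSplitGraph, hK.isCDC_of_conditions ⟨x, G.mem_splitKernel_self x⟩ hP hH⟩

end SimpleGraph

/-! ## Programs for first-order formulas over graphs

Register `0` receives truth values, register `1` holds the number of vertices, register `2` the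
constant `1`, register `3` is scratch space, and register `4 + i` holds the `i`-th variable. -/

namespace WordRAM

/-- The state `s` represents the graph `G` and the values of the first `k` variables. -/
structure Ready {n : ℕ} (G : SimpleGraph (Fin n)) (k : ℕ) (e : ℕ → Fin n) (s : State) : Prop where
  size : s.reg 1 = n
  one : s.reg 2 = 1
  mem : s.mem = (graphInput G).mem
  var : ∀ i < k, s.reg (4 + i) = e i

lemma State.setReg_reg_self (s : State) (x v : ℕ) : (s.setReg x v).reg x = v :=
  Function.update_self ..

lemma State.setReg_reg_of_ne (s : State) {x y : ℕ} (v : ℕ) (h : y ≠ x) :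
    (s.setReg x v).reg y = s.reg y :=
  Function.update_of_ne h ..

lemma Ready.setReg {n : ℕ} {G : SimpleGraph (Fin n)} {k : ℕ} {e : ℕ → Fin n} {s : State}
    (h : Ready G k e s) {x : ℕ} (hx : x = 0 ∨ x = 3 ∨ 4 + k ≤ x) (v : ℕ) :
    Ready G k e (s.setReg x v) where
  size := (s.setReg_reg_of_ne v (by omega)).trans h.size
  one := (s.setReg_reg_of_ne v (by omega)).trans h.one
  mem := h.mem
  var i hi := (s.setReg_reg_of_ne v (by omega)).trans (h.var i hi)

lemma Ready.succ {n : ℕ} {G : SimpleGraph (Fin n)} {k : ℕ} {e : ℕ → Fin n} {s : State}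
    (h : Ready G k e s) (a : Fin n) (ha : s.reg (4 + k) = a) :
    Ready G (k + 1) (Function.update e k a) s where
  size := h.size
  one := h.one
  mem := h.mem
  var i hi := by
    by_cases hik : i = k
    · rw [hik, ha, Function.update_self]
    · rw [Function.update_of_ne hik, h.var i (by omega)]

lemma Ready.of_succ {n : ℕ} {G : SimpleGraph (Fin n)} {k : ℕ} {e : ℕ → Fin n} {s : State}
    {a : Fin n} (h : Ready G (k + 1) (Function.update e k a) s) :
    Ready G k e s ∧ s.reg (4 + k) = a := by
  refine ⟨⟨h.size, h.one, h.mem, fun i hi => ?_⟩, ?_⟩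
  · rw [h.var i (by omega), Function.update_of_ne hi.ne]
  · rw [h.var k (by omega), Function.update_self]

/-- From the state `s`, the program `P` computes the truth value of `A` within `T` steps, without
changing what `Ready` describes. -/
def Evaluates (P : Program) (w : ℕ) {n : ℕ} (G : SimpleGraph (Fin n)) (k : ℕ) (e : ℕ → Fin n)
    (s : State) (A : Prop) (T : ℕ) : Prop :=
  ∃ (t : ℕ) (s' : State), Exec w P s t s' ∧ t ≤ T ∧ Ready G k e s' ∧
    (A → s'.reg 0 = 1) ∧ (¬ A → s'.reg 0 = 0)

/-- Some program computes the truth value of `A` in time `O(n ^ d)`, where `A` is a property of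
graphs and of the values of `k` variables. -/
def Decides (k d : ℕ) (A : ∀ n : ℕ, SimpleGraph (Fin n) → (ℕ → Fin n) → Prop) : Prop :=
  ∃ (P : Program) (C : ℕ), ∀ n : ℕ, 1 ≤ n → ∀ w : ℕ, (n + 1) ^ 2 ≤ 2 ^ w →
    ∀ (G : SimpleGraph (Fin n)) (e : ℕ → Fin n) (s : State), Ready G k e s →
      Evaluates P w G k e s (A n G e) (C * n ^ d)

variable {k d d' : ℕ} {A B : ∀ n : ℕ, SimpleGraph (Fin n) → (ℕ → Fin n) → Prop}

/-! ### Atomic formulas and connectives -/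

lemma one_mod_two_pow {n w : ℕ} (hn : 1 ≤ n) (hw : (n + 1) ^ 2 ≤ 2 ^ w) : 1 % 2 ^ w = 1 :=
  Nat.mod_eq_of_lt (by nlinarith)

lemma Decides.congr (h : Decides k d A) (hAB : ∀ n G e, A n G e ↔ B n G e) : Decides k d B := by
  have hAB' : A = B := by
    funext n G e
    exact propext (hAB n G e)
  exact hAB' ▸ h

lemma Decides.mono (h : Decides k d A) (hd : d ≤ d') : Decides k d' A := by
  obtain ⟨P, C, hP⟩ := h
  refine ⟨P, C, fun n hn w hw G e s hs => ?_⟩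
  obtain ⟨t, s', hex, ht, hrest⟩ := hP n hn w hw G e s hs
  exact ⟨t, s', hex, ht.trans (Nat.mul_le_mul_left C (Nat.pow_le_pow_right hn hd)), hrest⟩

lemma decides_false : Decides k 0 (fun _ _ _ => False) := by
  refine ⟨.instr (.const 0 0), 1, fun n hn w hw G e s hs => ⟨1, _, .instr _ s, by simp,
    hs.setReg (Or.inl rfl) _, False.elim, fun _ => ?_⟩⟩
  exact (State.setReg_reg_self ..).trans (Nat.zero_mod _)

lemma decides_eq {i j : ℕ} (hi : i < k) (hj : j < k) :
    Decides k 0 (fun _ _ e => e i = e j) := by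
  refine ⟨.ite (.eq (4 + i) (4 + j)) (.instr (.const 0 1)) (.instr (.const 0 0)), 2,
    fun n hn w hw G e s hs => ?_⟩
  by_cases h : e i = e j
  · refine ⟨2, _, .ite_true ?_ (.instr _ s), by simp, hs.setReg (Or.inl rfl) _, fun _ => ?_,
      fun h' => absurd h h'⟩
    · show s.reg (4 + i) = s.reg (4 + j)
      rw [hs.var i hi, hs.var j hj, h]
    · exact (State.setReg_reg_self ..).trans (one_mod_two_pow hn hw)
  · refine ⟨2, _, .ite_false ?_ (.instr _ s), by simp, hs.setReg (Or.inl rfl) _,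
      fun h' => absurd h' h, fun _ => ?_⟩
    · show ¬ s.reg (4 + i) = s.reg (4 + j)
      rw [hs.var i hi, hs.var j hj]
      exact fun h' => h (Fin.ext h')
    · exact (State.setReg_reg_self ..).trans (Nat.zero_mod _)

/-- Division by n recovers the row, so distinct entries occupy distinct cells. -/
lemma graphInput_mem {n : ℕ} (G : SimpleGraph (Fin n)) (i j : Fin n) :
    (G.Adj i j → (graphInput G).mem (i * n + j) = 1) ∧
      (¬ G.Adj i j → (graphInput G).mem (i * n + j) = 0) := by
  refine ⟨fun h => if_pos ⟨i, j, rfl, h⟩, fun h => if_neg ?_⟩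
  rintro ⟨i', j', heq, h'⟩
  have hdiv : ∀ a b : Fin n, (a.val * n + b.val) / n = a.val := fun a b => by
    rw [Nat.add_comm, Nat.add_mul_div_right _ _ (Nat.zero_lt_of_lt b.isLt),
      Nat.div_eq_of_lt b.isLt, Nat.zero_add]
  have hi : i = i' := Fin.ext (by rw [← hdiv i j, heq, hdiv])
  subst hi
  have hj : j = j' := Fin.ext (Nat.add_left_cancel heq)
  subst hj
  exact h h'

lemma decides_adj {i j : ℕ} (hi : i < k) (hj : j < k) :
    Decides k 0 (fun _ G e => G.Adj (e i) (e j)) := by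
  refine ⟨.seq (.instr (.mul 3 (4 + i) 1)) (.seq (.instr (.add 3 3 (4 + j))) (.instr (.load 0 3))),
    3, fun n hn w hw G e s hs => ?_⟩
  have hbound : (e i).val * n + (e j).val < 2 ^ w := by
    have h₁ : ((e i).val + 1) * n ≤ n * n := Nat.mul_le_mul_right n (e i).isLt
    have h₂ := (e j).isLt
    nlinarith
  have hs₁ := hs.setReg (x := 3) (Or.inr (Or.inl rfl)) (s.reg (4 + i) * s.reg 1 % 2 ^ w)
  have hmul : s.reg (4 + i) * s.reg 1 % 2 ^ w = (e i).val * n := by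
    rw [hs.var i hi, hs.size, Nat.mod_eq_of_lt (by omega)]
  have hs₂ := hs₁.setReg (x := 3) (Or.inr (Or.inl rfl)) ((e i).val * n + (e j).val)
  have hexec : Exec w _ s (1 + (1 + 1)) _ :=
    .seq (.instr (.mul 3 (4 + i) 1) s) (.seq (.instr (.add 3 3 (4 + j)) _) (.instr (.load 0 3) _))
  have hadd : Instr.apply w (.add 3 3 (4 + j)) (Instr.apply w (.mul 3 (4 + i) 1) s) =
      (s.setReg 3 (s.reg (4 + i) * s.reg 1 % 2 ^ w)).setReg 3 ((e i).val * n + (e j).val) := by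
    show State.setReg _ _ (_ % 2 ^ w) = _
    congr 1
    have h₁ : (Instr.apply w (.mul 3 (4 + i) 1) s).reg 3 = (e i).val * n :=
      (State.setReg_reg_self ..).trans hmul
    have h₂ : (Instr.apply w (.mul 3 (4 + i) 1) s).reg (4 + j) = e j := hs₁.var j hj
    rw [h₁, h₂, Nat.mod_eq_of_lt hbound]
  rw [hadd] at hexec
  have hload : ((Instr.load 0 3).apply w
      ((s.setReg 3 (s.reg (4 + i) * s.reg 1 % 2 ^ w)).setReg 3 ((e i).val * n + (e j).val))).reg 0 =
      (graphInput G).mem ((e i).val * n + (e j).val) := by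
    refine (State.setReg_reg_self ..).trans ?_
    rw [hs₂.mem, State.setReg_reg_self]
  refine ⟨_, _, hexec, by simp, hs₂.setReg (Or.inl rfl) _, ?_⟩
  rw [hload]
  exact graphInput_mem G (e i) (e j)

lemma Decides.imp (hA : Decides k d A) (hB : Decides k d' B) :
    Decides k (max d d') (fun n G e => A n G e → B n G e) := by
  obtain ⟨P, C, hP⟩ := hA.mono (le_max_left d d')
  obtain ⟨Q, D, hQ⟩ := hB.mono (le_max_right d d')
  refine ⟨.seq P (.ite (.eq 0 2) Q (.instr (.const 0 1))), C + D + 2,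
    fun n hn w hw G e s hs => ?_⟩
  obtain ⟨t, s', hex, ht, hs', hA₁, hA₀⟩ := hP n hn w hw G e s hs
  have hpow : 1 ≤ n ^ max d d' := Nat.one_le_pow _ _ hn
  by_cases h : A n G e
  · obtain ⟨t', s'', hex', ht', hs'', hB₁, hB₀⟩ := hQ n hn w hw G e s' hs'
    have htest : (Test.eq 0 2).Holds s' := (hA₁ h).trans hs'.one.symm
    refine ⟨_, s'', .seq hex (.ite_true htest hex'), by nlinarith, hs'', fun hAB => hB₁ (hAB h),
      fun hAB => hB₀ fun hB => hAB fun _ => hB⟩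
  · have htest : ¬ (Test.eq 0 2).Holds s' := by
      show ¬ s'.reg 0 = s'.reg 2
      rw [hA₀ h, hs'.one]
      exact zero_ne_one
    refine ⟨_, _, .seq hex (.ite_false htest (.instr _ s')), by nlinarith,
      hs'.setReg (Or.inl rfl) _, fun _ => ?_, fun hAB => absurd (fun hA => absurd hA h) hAB⟩
    exact (State.setReg_reg_self ..).trans (one_mod_two_pow hn hw)

lemma Decides.not (hA : Decides k d A) : Decides k d (fun n G e => ¬ A n G e) :=
  (hA.imp decides_false).mono (by simp)

lemma Decides.or (hA : Decides k d A) (hB : Decides k d' B) :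
    Decides k (max d d') (fun n G e => A n G e ∨ B n G e) :=
  (hA.not.imp hB).congr fun _ _ _ => or_iff_not_imp_left.symm

lemma Decides.and (hA : Decides k d A) (hB : Decides k d' B) :
    Decides k (max d d') (fun n G e => A n G e ∧ B n G e) :=
  (hA.imp hB.not).not.congr fun _ _ _ => by tauto

lemma Decides.iff (hA : Decides k d A) (hB : Decides k d' B) :
    Decides k (max d d') (fun n G e => A n G e ↔ B n G e) :=
  (((hA.imp hB).and (hB.imp hA)).mono (by simp [max_comm])).congr fun _ _ _ => iff_def.symm

/-! ### Quantifiers -/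

/-- The loop that evaluates a property of the variable `k` for all its values, and stops early if
the property fails. -/
def forallLoop (k : ℕ) (P : Program) : Program :=
  .while (.lt (4 + k) 1)
    (.seq P (.ite (.eq 0 2) (.instr (.add (4 + k) (4 + k) 2)) (.instr (.move (4 + k) 1))))

lemma exec_forallLoop_of_not_lt {w n k : ℕ} {P : Program} {s : State} (h₁ : s.reg 1 = n)
    (h : s.reg (4 + k) = n) : Exec w (forallLoop k P) s 1 s :=
  .while_false (by
    show ¬ s.reg (4 + k) < s.reg 1
    rw [h₁, h]
    exact lt_irrefl n)

/-- Induction on the number m + 1 of values left; the last value is separate because its successor n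
is not in `Fin n`. A round costs T plus the loop test, the branch test and the counter update; the
final 1 is the failing loop test. Register 0 keeps the truth value of the last instance evaluated,
which is the answer. -/
lemma evaluates_forallLoop {P : Program} {w n T : ℕ} (hn : 1 ≤ n) (hw : (n + 1) ^ 2 ≤ 2 ^ w)
    {G : SimpleGraph (Fin n)} {e : ℕ → Fin n} {φ : Fin n → Prop}
    (hP : ∀ (a : Fin n) (s : State), Ready G (k + 1) (Function.update e k a) s →
      Evaluates P w G (k + 1) (Function.update e k a) s (φ a) T)
    (m : ℕ) (a : Fin n) (hm : n = a + (m + 1)) (s : State) (hs : Ready G k e s)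
    (ha : s.reg (4 + k) = a) :
    Evaluates (forallLoop k P) w G k e s (∀ b, a ≤ b → φ b) ((m + 1) * (T + 3) + 1) := by
  induction m generalizing a s with
  | zero =>
    obtain ⟨t, s', hex, ht, hs', h₁, h₀⟩ := hP a s (hs.succ a ha)
    obtain ⟨hs₁, ha'⟩ := hs'.of_succ
    have htest : (Test.lt (4 + k) 1).Holds s := by
      show s.reg (4 + k) < s.reg 1
      rw [ha, hs.size]
      exact a.isLt
    have hall : (∀ b, a ≤ b → φ b) ↔ φ a := by
      refine ⟨fun h => h a le_rfl, fun h b hab => ?_⟩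
      have hba : b = a := Fin.ext (by have := b.isLt; have := Fin.le_def.1 hab; omega)
      exact hba ▸ h
    rw [hall]
    by_cases hφ : φ a
    · have hbranch : (Test.eq 0 2).Holds s' := (h₁ hφ).trans hs₁.one.symm
      have hval : (s'.reg (4 + k) + s'.reg 2) % 2 ^ w = n := by
        rw [ha', hs₁.one, Nat.mod_eq_of_lt (by nlinarith)]
        omega
      have hs₂ := hs₁.setReg (x := 4 + k) (Or.inr (Or.inr le_rfl))
        ((s'.reg (4 + k) + s'.reg 2) % 2 ^ w)
      refine ⟨_, _, .while_true htest (.seq hex (.ite_true hbranch (.instr _ s')))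
        (exec_forallLoop_of_not_lt hs₂.size ((State.setReg_reg_self ..).trans hval)),
        by omega, hs₂, ?_⟩
      have hreg := s'.setReg_reg_of_ne ((s'.reg (4 + k) + s'.reg 2) % 2 ^ w) (by omega : 0 ≠ 4 + k)
      exact ⟨fun h => hreg.trans (h₁ h), fun h => hreg.trans (h₀ h)⟩
    · have hbranch : ¬ (Test.eq 0 2).Holds s' := by
        show ¬ s'.reg 0 = s'.reg 2
        rw [h₀ hφ, hs₁.one]
        exact zero_ne_one
      have hs₂ := hs₁.setReg (x := 4 + k) (Or.inr (Or.inr le_rfl)) (s'.reg 1)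
      refine ⟨_, _, .while_true htest (.seq hex (.ite_false hbranch (.instr _ s')))
        (exec_forallLoop_of_not_lt hs₂.size ((State.setReg_reg_self ..).trans hs₁.size)),
        by omega, hs₂, ?_⟩
      have hreg := s'.setReg_reg_of_ne (s'.reg 1) (by omega : 0 ≠ 4 + k)
      exact ⟨fun h => hreg.trans (h₁ h), fun h => hreg.trans (h₀ h)⟩
  | succ m ih =>
    obtain ⟨t, s', hex, ht, hs', h₁, h₀⟩ := hP a s (hs.succ a ha)
    obtain ⟨hs₁, ha'⟩ := hs'.of_succ
    have htest : (Test.lt (4 + k) 1).Holds s := by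
      show s.reg (4 + k) < s.reg 1
      rw [ha, hs.size]
      exact a.isLt
    have hmul : (m + 1 + 1) * (T + 3) = (m + 1) * (T + 3) + (T + 3) := Nat.succ_mul _ _
    by_cases hφ : φ a
    · have hbranch : (Test.eq 0 2).Holds s' := (h₁ hφ).trans hs₁.one.symm
      have hval : (s'.reg (4 + k) + s'.reg 2) % 2 ^ w = a.val + 1 := by
        rw [ha', hs₁.one, Nat.mod_eq_of_lt (by nlinarith)]
      have hs₂ := hs₁.setReg (x := 4 + k) (Or.inr (Or.inr le_rfl))
        ((s'.reg (4 + k) + s'.reg 2) % 2 ^ w)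
      obtain ⟨t', s'', hex', ht', hs'', h₁', h₀'⟩ := ih ⟨a + 1, by omega⟩
        (by show n = a.val + 1 + (m + 1); omega) _ hs₂ ((State.setReg_reg_self ..).trans hval)
      have hall : (∀ b, a ≤ b → φ b) ↔ ∀ b : Fin n, (⟨a + 1, by omega⟩ : Fin n) ≤ b → φ b := by
        refine ⟨fun h b hab => h b (Fin.le_def.2 (Nat.le_of_succ_le (Fin.le_def.1 hab))),
          fun h b hab => ?_⟩
        rcases hab.eq_or_lt with rfl | hlt
        · exact hφ
        · exact h b (Fin.le_def.2 (Fin.lt_def.1 hlt))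
      rw [hall]
      exact ⟨_, s'', .while_true htest (.seq hex (.ite_true hbranch (.instr _ s'))) hex',
        by omega, hs'', h₁', h₀'⟩
    · have hbranch : ¬ (Test.eq 0 2).Holds s' := by
        show ¬ s'.reg 0 = s'.reg 2
        rw [h₀ hφ, hs₁.one]
        exact zero_ne_one
      have hs₂ := hs₁.setReg (x := 4 + k) (Or.inr (Or.inr le_rfl)) (s'.reg 1)
      refine ⟨_, _, .while_true htest (.seq hex (.ite_false hbranch (.instr _ s')))
        (exec_forallLoop_of_not_lt hs₂.size ((State.setReg_reg_self ..).trans hs₁.size)),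
        by omega, hs₂, fun h => absurd (h a le_rfl) hφ, fun _ => ?_⟩
      exact (s'.setReg_reg_of_ne (s'.reg 1) (by omega : 0 ≠ 4 + k)).trans (h₀ hφ)

lemma Decides.all (hA : Decides (k + 1) d A) :
    Decides k (d + 1) (fun n G e => ∀ a, A n G (Function.update e k a)) := by
  obtain ⟨P, C, hP⟩ := hA
  -- The 5 covers 3 overhead steps per round, the initialisation and the last loop test.
  refine ⟨.seq (.instr (.const (4 + k) 0)) (forallLoop k P), C + 5, fun n hn w hw G e s hs => ?_⟩
  obtain ⟨t, s', hex, ht, hs', h₁, h₀⟩ := evaluates_forallLoop hn hw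
    (fun a s hs => hP n hn w hw G (Function.update e k a) s hs) (n - 1) ⟨0, hn⟩
    (by show n = 0 + (n - 1 + 1); omega) _ (hs.setReg (Or.inr (Or.inr le_rfl)) (0 % 2 ^ w))
    ((State.setReg_reg_self ..).trans (Nat.zero_mod _))
  have hall : (∀ b : Fin n, (⟨0, hn⟩ : Fin n) ≤ b → A n G (Function.update e k b)) ↔
      ∀ b, A n G (Function.update e k b) :=
    ⟨fun h b => h b (Fin.le_def.2 (Nat.zero_le _)), fun h b _ => h b⟩
  rw [hall] at h₁ h₀
  refine ⟨_, s', .seq (.instr _ s) hex, ?_, hs', h₁, h₀⟩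
  rw [Nat.sub_add_cancel hn] at ht
  have hpow : n ≤ n ^ (d + 1) := Nat.le_self_pow (Nat.succ_ne_zero d) n
  have hmul : n * (C * n ^ d) = C * n ^ (d + 1) := by ring
  nlinarith

lemma Decides.ex (hA : Decides (k + 1) d A) :
    Decides k (d + 1) (fun n G e => ∃ a, A n G (Function.update e k a)) :=
  hA.not.all.not.congr fun _ _ _ => by push Not; rfl

/-! ## The program for CDC split graphs -/

lemma decides_mem_splitKernel {x i : ℕ} (hx : x < k) (hi : i < k) :
    Decides k 1 (fun _ G e => e i ∈ G.splitKernel (e x)) := by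
  have hx' : x < k + 1 := by omega
  have hi' : i < k + 1 := by omega
  have hk : k < k + 1 := by omega
  have htwin := (((decides_eq hk hx').or (decides_adj hk hx')).iff
    ((decides_eq hk hi').or (decides_adj hk hi'))).all
  have hnbr := ((decides_eq hk hx').not.and ((decides_adj hk hx').not.and
    (decides_adj hk hi'))).ex
  refine ((htwin.or hnbr).mono (by simp)).congr fun n G e => ?_
  simp [SimpleGraph.splitKernel, hx.ne, hi.ne]

lemma decides_hasExtraNeighbor {x i j : ℕ} (hx : x < k) (hi : i < k) (hj : j < k) :
    Decides k 2 (fun _ G e => G.HasExtraNeighbor (G.splitKernel (e x)) (e i) (e j)) := by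
  have hx' : x < k + 1 := by omega
  have hi' : i < k + 1 := by omega
  have hj' : j < k + 1 := by omega
  have hk : k < k + 1 := by omega
  refine (((decides_mem_splitKernel hx' hk).not.and
    ((decides_adj hi' hk).and (decides_adj hj' hk).not)).ex.mono (by simp)).congr fun n G e => ?_
  simp [SimpleGraph.HasExtraNeighbor, hx.ne, hi.ne, hj.ne]

lemma decides_incomparable {x i j : ℕ} (hx : x < k) (hi : i < k) (hj : j < k) :
    Decides k 2 (fun _ G e => G.Incomparable (G.splitKernel (e x)) (e i) (e j)) :=
  (decides_hasExtraNeighbor hx hi hj).and (decides_hasExtraNeighbor hx hj hi)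

/-- Variable 0 defines the kernel; 1 to 4 are x, y₀, v, y. Four quantifiers and cost 2 for
incomparability give 6. -/
lemma decides_privateCondition :
    Decides 1 6 (fun _ G e => G.PrivateCondition (G.splitKernel (e 0))) := by
  have h := ((decides_mem_splitKernel (k := 3) (x := 0) (i := 1) (by simp) (by simp)).imp
    ((decides_mem_splitKernel (x := 0) (i := 2) (by simp) (by simp)).imp
    ((decides_incomparable (x := 0) (i := 1) (j := 2) (by simp) (by simp) (by simp)).imp
    ((decides_mem_splitKernel (x := 0) (i := 3) (by simp) (by simp)).not.and
    ((decides_adj (i := 1) (j := 3) (by simp) (by simp)).and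
    ((decides_mem_splitKernel (x := 0) (i := 4) (by simp) (by simp)).imp
    ((decides_incomparable (x := 0) (i := 1) (j := 4) (by simp) (by simp) (by simp)).imp
    (decides_adj (i := 4) (j := 3) (by simp) (by simp)).not)).all)).ex))).all.all
  refine (h.mono (by simp)).congr fun n G e => ?_
  simp [SimpleGraph.PrivateCondition]

/-- Variables 1 to 5 are x, y, z, w, v. Five quantifiers and cost 1 for kernel membership give 6. -/
lemma decides_hellyCondition :
    Decides 1 6 (fun _ G e => G.HellyCondition (G.splitKernel (e 0))) := by
  have hadj : ∀ i, i < 6 → Decides 6 0 (fun _ G e => ¬ G.Adj (e i) (e 5)) := fun i hi =>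
    (decides_adj hi (by simp)).not
  have hmiss := ((hadj 1 (by simp)).and (hadj 2 (by simp))).or
    (((hadj 1 (by simp)).and (hadj 3 (by simp))).or ((hadj 2 (by simp)).and (hadj 3 (by simp))))
  have h := ((decides_mem_splitKernel (k := 4) (x := 0) (i := 1) (by simp) (by simp)).imp
    ((decides_mem_splitKernel (x := 0) (i := 2) (by simp) (by simp)).imp
    ((decides_mem_splitKernel (x := 0) (i := 3) (by simp) (by simp)).imp
    ((decides_mem_splitKernel (x := 0) (i := 4) (by simp) (by simp)).and
    ((decides_mem_splitKernel (x := 0) (i := 5) (by simp) (by simp)).not.imp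
    (hmiss.imp (hadj 4 (by simp)))).all).ex))).all.all.all
  refine (h.mono (by simp)).congr fun n G e => ?_
  simp [SimpleGraph.HellyCondition, SimpleGraph.MissesTwo]

lemma decides_splitCDCCriterion :
    Decides 1 6 (fun _ G e => G.SplitCDCCriterion (G.splitKernel (e 0))) := by
  have hmem : ∀ k i, i < k + 1 → Decides (k + 1) 1 (fun _ G e => e i ∈ G.splitKernel (e 0)) :=
    fun k i hi => decides_mem_splitKernel (Nat.succ_pos k) hi
  have hadj := decides_adj (k := 3) (i := 1) (j := 2) (by simp) (by simp)
  have heq := decides_eq (k := 3) (i := 1) (j := 2) (by simp) (by simp)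
  have hclique := ((hmem 2 1 (by simp)).imp
    ((hmem 2 2 (by simp)).imp (heq.not.imp hadj))).all.all
  have hindep := ((hmem 2 1 (by simp)).not.imp ((hmem 2 2 (by simp)).not.imp hadj.not)).all.all
  have hmax := ((hmem 1 1 (by simp)).not.imp ((hmem 2 2 (by simp)).and hadj.not).ex).all
  refine (((hclique.and (hindep.and hmax)).and
    (decides_privateCondition.and decides_hellyCondition)).mono (by simp)).congr fun n G e => ?_
  simp [SimpleGraph.SplitCDCCriterion]

lemma decides_isSplitGraph_and_isCDC :
    Decides 0 8 (fun _ G _ => G.IsSplitGraph ∧ G.IsCDC) := by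
  refine (decides_splitCDCCriterion.ex.mono (by simp)).congr fun n G e => ?_
  have : Nonempty (Fin n) := ⟨e 0⟩
  rw [SimpleGraph.isSplitGraph_and_isCDC_iff]
  simp

end WordRAM

/-- Some fixed word RAM program decides, within `C * n ^ 8` steps and with words of `O(log n)` bits
(any word length `w ≥ c * log₂ (n + 1)` will do), whether a given graph with `n ≥ 1` vertices is a
CDC split graph. -/
theorem mainTheorem8 :
    ∃ (P : WordRAM.Program) (c C : ℕ), 2 ≤ c ∧
      ∀ (n : ℕ), 1 ≤ n → ∀ (w : ℕ), (n + 1) ^ c ≤ 2 ^ w → ∀ (G : SimpleGraph (Fin n)),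
        WordRAM.Answers P w G (G.IsSplitGraph ∧ G.IsCDC) (C * n ^ 8) := by
  obtain ⟨P, C, hP⟩ := WordRAM.decides_isSplitGraph_and_isCDC
  -- Two initial steps put n in register 1 and 1 in register 2. With c = 2, all addresses and
  -- counters fit in a word.
  refine ⟨.seq (.instr (.move 1 0)) (.seq (.instr (.const 2 1)) P), 2, C + 2, le_rfl,
    fun n hn w hw G => ?_⟩
  have hready : WordRAM.Ready G 0 (fun _ => ⟨0, hn⟩)
      (((WordRAM.graphInput G).setReg 1 n).setReg 2 (1 % 2 ^ w)) :=
    ⟨rfl, WordRAM.one_mod_two_pow hn hw, rfl, fun i hi => absurd hi (Nat.not_lt_zero i)⟩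
  obtain ⟨t, s, hex, ht, -, hs⟩ := hP n hn w hw G _ _ hready
  refine ⟨_, s, .seq (.instr _ _) (.seq (.instr _ _) hex), ?_, hs⟩
  have hpow : 1 ≤ n ^ 8 := Nat.one_le_pow _ _ hn
  nlinarith
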